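/- Let $L$ be a frame. A sublocale of $L$ is a subset $S\subseteq L$ closed under arbitrary meets and such that $a\to s\in S$ for all $a\in L$, $s\in S$; it is a frame in the inherited order, with surjection $s:L\to S$, $s(a)=\bigwedge\{t\in S\mid a\le t\}$. The sublocales of $L$, ordered by inclusion, form a coframe $\mathsf{S}(L)$; for $a\in L$ put $\mathfrak{c}(a)=\{b\in L\mid a\le b\}$ and $\mathfrak{o}(a)=\{b\in L\mid a\to b=b\}$. Let $\mathsf{S}_b(L)\subseteq\mathsf{S}(L)$ be the collection of all joins of complemented sublocales; a sublocale is called smooth if it belongs to $\mathsf{S}_b(L)$. Let $\mathsf{S}_{\mathfrak{o}}(L)$ be the coframe of intersections of open sublocales $\mathfrak{o}(x)$, and let $\mathit{fit}(T)=\bigcap\{\mathfrak{o}(x)\mid T\subseteq\mathfrak{o}(x)\}$ for $T\in\mathsf{S}(L)$. A subcolocale of a coframe $C$ is a subset $D\subseteq C$ closed under arbitrary joins and such that $d\setminus c\in D$ for all $d\in D$, $c\in C$; it is a coframe in the inherited order. A strictly zero-dimensional biframe is a pair $(L,\mathcal{D})$ with $\mathcal{D}\subseteq\mathsf{S}(L)$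 a subcolocale containing $L$; a morphism $(L,\mathcal{D})\to(M,\mathcal{E})$ is a frame map $f:L\to M$ such that $\mathfrak{c}(a)\mapsto\mathfrak{c}(f(a))$ extends to a coframe map $\mathcal{D}\to\mathcal{E}$ (a map preserving arbitrary meets and finite joins). A Raney extension is a pair $(L,\mathcal{F})$ with $\mathcal{F}\subseteq\mathsf{S}_{\mathfrak{o}}(L)$ a subcolocale containing all open sublocales; a morphism $(L,\mathcal{F})\to(M,\mathcal{G})$ is a frame map $f:L\to M$ such that $\mathfrak{o}(a)\mapsto\mathfrak{o}(f(a))$ extends to a coframe map $\mathcal{F}\to\mathcal{G}$. The pair $(L,\mathsf{S}_b(L))$ is a strictly zero-dimensional biframe and $(L,\mathit{fit}[\mathsf{S}_b(L)])$ is a Raney extension. A meet $\bigwedge_i x_i$ in a frame is exact if $(\bigwedge_i x_i)\vee y=\bigwedge_i(x_i\vee y)$ for all $y$. A frame map $f$ is exact if, for every exact meet $\bigwedge_i x_i$, the meet $\bigwedge_i f(x_i)$ is exact and equals $f(\bigwedge_i x_i)$. A sublocale is exact if its surjection is exact. Then, for every frame $L$ and every sublocale $S\subseteq L$ with surjection $s:L\to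 S$: \begin{enumerate} \item $S$ is smooth if and only if $s$ is a morphism $(L,\mathsf{S}_b(L))\to(S,\mathsf{S}_b(S))$ of strictly zero-dimensional biframes. \item $S$ is exact if and only if $s$ is a morphism $(L,\mathit{fit}[\mathsf{S}_b(L)])\to(S,\mathit{fit}[\mathsf{S}_b(S)])$ of Raney extensions. \end{enumerate} -/

import Mathlib

universe u v

/-! ### Coframe maps and subcolocales -/

/-- A coframe map: it preserves arbitrary meets (hence the top) and finite joins (hence the
bottom). -/
structure CoframeHom (C : Type u) (D : Type v) [Order.Coframe C] [Order.Coframe D] where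
  toFun : C → D
  map_sInf' : ∀ s : Set C, toFun (sInf s) = sInf (toFun '' s)
  map_sup' : ∀ a b : C, toFun (a ⊔ b) = toFun a ⊔ toFun b
  map_bot' : toFun ⊥ = ⊥

/-- A subcolocale of a coframe `C`: a subset closed under all joins and under `d ↦ d \ c`
for every `c : C`. -/
structure Subcolocale (C : Type u) [Order.Coframe C] where
  carrier : Set C
  sSup_mem' : ∀ s ⊆ carrier, sSup s ∈ carrier
  sdiff_mem' : ∀ d ∈ carrier, ∀ c : C, d \ c ∈ carrier

theorem sdiff_eq_inf_of_isCompl {C : Type u} [Order.Coframe C] {x y : C} (h : IsCompl x y)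
    (c : C) : c \ x = c ⊓ y := by
  refine eq_of_forall_ge_iff fun z => ?_
  rw [sdiff_le_iff]
  constructor
  · intro hc
    calc c ⊓ y ≤ (x ⊔ z) ⊓ y := inf_le_inf_right y hc
      _ = z ⊓ y := by rw [inf_sup_right, h.inf_eq_bot, bot_sup_eq]
      _ ≤ z := inf_le_left
  · intro hc
    calc c = c ⊓ (x ⊔ y) := by rw [h.sup_eq_top, inf_top_eq]
      _ = c ⊓ x ⊔ c ⊓ y := inf_sup_left ..
      _ ≤ x ⊔ z := sup_le_sup inf_le_right hc

namespace Subcolocale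

variable {C : Type u} [Order.Coframe C] (D : Subcolocale C)

/-- The elements of a subcolocale, ordered as in `C`. -/
abbrev Elem : Type u := {c : C // c ∈ D.carrier}

instance : SupSet D.Elem where
  sSup s := ⟨sSup (Subtype.val '' s), D.sSup_mem' _ (by rintro _ ⟨x, -, rfl⟩; exact x.2)⟩

theorem isLUB_sSup_elem (s : Set D.Elem) : IsLUB s (sSup s) :=
  ⟨fun x hx => show x.1 ≤ sSup (Subtype.val '' s) from le_sSup ⟨x, hx, rfl⟩,
    fun y hy => show sSup (Subtype.val '' s) ≤ y.1 from
      sSup_le (by rintro _ ⟨x, hx, rfl⟩; exact hy hx)⟩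

/-- A subcolocale is a complete lattice in the inherited order. Joins are computed in `C`;
the meet of a family is the largest element of the subcolocale below all its members. -/
noncomputable instance : CompleteLattice D.Elem :=
  completeLatticeOfSup D.Elem D.isLUB_sSup_elem

theorem sup_mem {a b : C} (ha : a ∈ D.carrier) (hb : b ∈ D.carrier) : a ⊔ b ∈ D.carrier := by
  rw [← sSup_pair]
  exact D.sSup_mem' _ (by rintro x (rfl | rfl) <;> assumption)

theorem coe_sup (a b : D.Elem) : ((a ⊔ b : D.Elem) : C) = (a : C) ⊔ (b : C) := by
  apply le_antisymm
  · exact show (a ⊔ b : D.Elem) ≤ ⟨(a : C) ⊔ b, D.sup_mem a.2 b.2⟩ from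
      sup_le (show (a : C) ≤ (a : C) ⊔ b from le_sup_left)
        (show (b : C) ≤ (a : C) ⊔ b from le_sup_right)
  · exact sup_le (show a ≤ a ⊔ b from le_sup_left) (show b ≤ a ⊔ b from le_sup_right)

noncomputable instance : Order.Coframe D.Elem := .ofMinimalAxioms {
  iInf_sup_le_sup_sInf := fun a s => by
    let m : D.Elem := ⨅ b ∈ s, a ⊔ b
    have h1 : (m : C) \ (a : C) ∈ D.carrier := D.sdiff_mem' _ m.2 _
    have h2 : (⟨(m : C) \ (a : C), h1⟩ : D.Elem) ≤ sInf s := by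
      refine le_sInf fun b hb => ?_
      change (m : C) \ (a : C) ≤ (b : C)
      rw [sdiff_le_iff, ← coe_sup]
      exact (iInf₂_le b hb : m ≤ a ⊔ b)
    have h3 : (m : C) \ (a : C) ≤ ((sInf s : D.Elem) : C) := h2
    change (m : C) ≤ ((a ⊔ sInf s : D.Elem) : C)
    rw [coe_sup]
    exact sdiff_le_iff.1 h3 }

end Subcolocale

/-! ### Open, closed, smooth and fitted sublocales -/

namespace Sublocale

variable {L : Type u} [Order.Frame L]

/-- The open sublocale `𝔬(a) = {b | a → b = b}`. -/
def opens (a : L) : Sublocale L where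
  carrier := {b | a ⇨ b = b}
  sInf_mem' s hs := by
    refine le_antisymm (le_sInf fun b hb => ?_) le_himp
    calc a ⇨ sInf s ≤ a ⇨ b := himp_le_himp_left (sInf_le hb)
      _ = b := hs hb
  himp_mem' c b hb := by
    change a ⇨ c ⇨ b = c ⇨ b
    rw [himp_left_comm, show a ⇨ b = b from hb]

/-- The closed sublocale `𝔠(a) = ↑a`. -/
def closeds (a : L) : Sublocale L where
  carrier := {b | a ≤ b}
  sInf_mem' _ hs := le_sInf fun _ hb => hs hb
  himp_mem' _ _ hb := le_trans hb le_himp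

theorem mem_inf_of_mem {S T : Sublocale L} {x : L} (hS : x ∈ S) (hT : x ∈ T) : x ∈ S ⊓ T := by
  let I : Sublocale L :=
    { carrier := {y | y ∈ S ∧ y ∈ T}
      sInf_mem' := fun s hs => ⟨sInf_mem fun _ hy => (hs hy).1, sInf_mem fun _ hy => (hs hy).2⟩
      himp_mem' := fun _ _ hb => ⟨himp_mem hb.1, himp_mem hb.2⟩ }
  have h : I ≤ S ⊓ T := le_inf (fun _ hy => hy.1) (fun _ hy => hy.2)
  exact h (show x ∈ I from ⟨hS, hT⟩)

theorem mem_opens {a b : L} : b ∈ opens a ↔ a ⇨ b = b := Iff.rfl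

theorem mem_closeds {a b : L} : b ∈ closeds a ↔ a ≤ b := Iff.rfl

theorem isCompl_opens_closeds (a : L) : IsCompl (opens a) (closeds a) := by
  constructor
  · intro T ho hc x hx
    have h1 : a ⇨ x = x := ho hx
    have h2 : a ≤ x := hc hx
    have : x = ⊤ := by rw [← h1, himp_eq_top_iff]; exact h2
    rw [this]; exact top_mem
  · intro T ho hc x _
    have h1 : a ⇨ x ∈ T := ho (mem_opens.2 himp_idem)
    have h2 : a ⊔ x ∈ T := hc (mem_closeds.2 le_sup_left)
    have h3 : (a ⇨ x) ⊓ (a ⊔ x) = x := by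
      apply le_antisymm
      · rw [inf_sup_left]
        exact sup_le (by rw [himp_inf_self]; exact inf_le_left) inf_le_right
      · exact le_inf le_himp le_sup_right
    rw [← h3]; exact inf_mem h1 h2

theorem opens_sup (a b : L) : opens (a ⊔ b) = opens a ⊔ opens b := by
  apply le_antisymm
  · intro x hx
    have h1 : (a ⊔ b) ⇨ x = x := hx
    rw [← h1, sup_himp_distrib]
    exact inf_mem ((le_sup_left : opens a ≤ opens a ⊔ opens b) (mem_opens.2 himp_idem))
      ((le_sup_right : opens b ≤ opens a ⊔ opens b) (mem_opens.2 himp_idem))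
  · refine sup_le (fun x hx => ?_) (fun x hx => ?_)
    · exact le_antisymm ((himp_le_himp_right le_sup_left).trans_eq hx) le_himp
    · exact le_antisymm ((himp_le_himp_right le_sup_right).trans_eq hx) le_himp

/-- A sublocale is smooth if it is a join, in the coframe of sublocales, of complemented
sublocales. -/
def IsSmooth (S : Sublocale L) : Prop :=
  ∃ 𝒞 : Set (Sublocale L), (∀ C ∈ 𝒞, IsComplemented C) ∧ S = sSup 𝒞

/-- A sublocale is fitted if it is an intersection of open sublocales. -/
def IsFitted (S : Sublocale L) : Prop := ∃ X : Set L, S = ⨅ x ∈ X, opens x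

/-- The fitting of a sublocale: the intersection of the open sublocales containing it. -/
def fit (S : Sublocale L) : Sublocale L := ⨅ x ∈ {x : L | S ≤ opens x}, opens x

theorem isFitted_fit (S : Sublocale L) : IsFitted (fit S) := ⟨_, rfl⟩

theorem isFitted_opens (a : L) : IsFitted (opens a) := ⟨{a}, by simp⟩

theorem le_fit (S : Sublocale L) : S ≤ fit S := le_iInf₂ fun _ hx => hx

theorem fit_le_iff {S T : Sublocale L} (hT : IsFitted T) : fit S ≤ T ↔ S ≤ T := by
  refine ⟨(le_fit S).trans, fun h => ?_⟩
  obtain ⟨X, rfl⟩ := hT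
  exact le_iInf₂ fun x hx => iInf₂_le x (h.trans (iInf₂_le x hx))

theorem fit_eq {T : Sublocale L} (hT : IsFitted T) : fit T = T :=
  le_antisymm ((fit_le_iff hT).2 le_rfl) (le_fit T)

theorem isFitted_sInf {s : Set (Sublocale L)} (hs : ∀ T ∈ s, IsFitted T) : IsFitted (sInf s) := by
  have h : fit (sInf s) = sInf s :=
    le_antisymm (le_sInf fun T hT => (fit_le_iff (hs T hT)).2 (sInf_le hT)) (le_fit _)
  exact h ▸ isFitted_fit _

theorem IsFitted.sup {S T : Sublocale L} (hS : IsFitted S) (hT : IsFitted T) :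
    IsFitted (S ⊔ T) := by
  obtain ⟨X, rfl⟩ := hS
  obtain ⟨Y, rfl⟩ := hT
  have h : fit ((⨅ x ∈ X, opens x) ⊔ ⨅ y ∈ Y, opens y) ≤
      (⨅ x ∈ X, opens x) ⊔ ⨅ y ∈ Y, opens y := by
    simp only [iInf_sup_eq, sup_iInf_eq]
    refine le_iInf₂ fun x hx => le_iInf₂ fun y hy => ?_
    rw [← opens_sup, fit_le_iff (isFitted_opens _), opens_sup]
    exact (iInf₂_le x hx).trans (iInf₂_le y hy)
  exact le_antisymm h (le_fit _) ▸ isFitted_fit _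

/-- Every sublocale is an intersection of sublocales of the form `𝔬(z) ∨ 𝔠(w)`. -/
theorem eq_sInf_opens_sup_closeds (T : Sublocale L) :
    T = sInf {P | T ≤ P ∧ ∃ z w : L, P = opens z ⊔ closeds w} := by
  apply le_antisymm (le_sInf fun P hP => hP.1)
  intro z hz
  have hw : ((T.restrict z : T) : L) ∈ T := (T.restrict z).2
  have hzw : z ≤ ((T.restrict z : T) : L) := T.giRestrict.gc.le_u_l z
  have hT : T ≤ opens z ⊔ closeds ((T.restrict z : T) : L) := by
    intro t ht
    have h1 : ((T.restrict z : T) : L) ⊓ (z ⇨ t) ≤ t := by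
      rw [← le_himp_iff]
      have hmem : (z ⇨ t) ⇨ t ∈ T := himp_mem ht
      have : T.restrict z ≤ ⟨(z ⇨ t) ⇨ t, hmem⟩ :=
        (T.giRestrict.gc z _).2 (by
          change z ≤ (z ⇨ t) ⇨ t
          rw [le_himp_iff, inf_himp]; exact inf_le_right)
      exact this
    have h2 : (z ⇨ t) ⊓ (((T.restrict z : T) : L) ⊔ t) = t := by
      apply le_antisymm
      · rw [inf_sup_left]
        exact sup_le (by rw [inf_comm]; exact h1) inf_le_right
      · exact le_inf le_himp le_sup_right
    rw [← h2]
    exact inf_mem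
      ((le_sup_left : opens z ≤ opens z ⊔ closeds ((T.restrict z : T) : L))
        (mem_opens.2 himp_idem))
      ((le_sup_right : closeds ((T.restrict z : T) : L) ≤
        opens z ⊔ closeds ((T.restrict z : T) : L)) (mem_closeds.2 le_sup_left))
  have hz' : z ∈ opens z ⊔ closeds ((T.restrict z : T) : L) :=
    (sInf_le ⟨hT, z, _, rfl⟩ : sInf {P | T ≤ P ∧ ∃ z w : L, P = opens z ⊔ closeds w} ≤ _) hz
  have h3 : closeds z ⊓ (opens z ⊔ closeds ((T.restrict z : T) : L)) ≤
      closeds ((T.restrict z : T) : L) := by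
    rw [inf_sup_left, inf_comm, (isCompl_opens_closeds z).inf_eq_bot, bot_sup_eq]
    exact inf_le_right
  have h5 : ((T.restrict z : T) : L) ≤ z :=
    mem_closeds.1 (h3 (mem_inf_of_mem (mem_closeds.2 le_rfl) hz'))
  rw [le_antisymm hzw h5]
  exact hw

/-- Joins of complemented sublocales are stable under differences. -/
theorem IsSmooth.sdiff {S : Sublocale L} (hS : IsSmooth S) (T : Sublocale L) :
    IsSmooth (S \ T) := by
  obtain ⟨𝒞, h𝒞, rfl⟩ := hS
  refine ⟨{U | IsComplemented U ∧ U ≤ sSup 𝒞 \ T}, fun U hU => hU.1, ?_⟩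
  refine le_antisymm ?_ (sSup_le fun U hU => hU.2)
  rw [sdiff_le_iff]
  refine sSup_le fun C hC => ?_
  have hT := eq_sInf_opens_sup_closeds T
  set V := sSup {U | IsComplemented U ∧ U ≤ sSup 𝒞 \ T}
  rw [hT, sInf_sup_eq]
  refine le_iInf₂ fun P hP => ?_
  obtain ⟨hTP, z, w, rfl⟩ := hP
  rw [← sdiff_le_iff]
  refine le_sSup ⟨?_, sdiff_le_sdiff (le_sSup hC) hTP⟩
  have hc : IsCompl (opens z ⊔ closeds w) (closeds z ⊓ opens w) :=
    (isCompl_opens_closeds z).sup_inf (isCompl_opens_closeds w).symm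
  rw [sdiff_eq_inf_of_isCompl hc]
  exact (h𝒞 C hC).inf ⟨_, hc.symm⟩

theorem isSmooth_sSup {s : Set (Sublocale L)} (hs : ∀ T ∈ s, IsSmooth T) :
    IsSmooth (sSup s) := by
  refine ⟨{U | IsComplemented U ∧ U ≤ sSup s}, fun U hU => hU.1, ?_⟩
  refine le_antisymm (sSup_le fun T hT => ?_) (sSup_le fun U hU => hU.2)
  obtain ⟨𝒞, h𝒞, rfl⟩ := hs T hT
  exact sSup_le fun C hC => le_sSup ⟨h𝒞 C hC, (le_sSup hC).trans (le_sSup hT)⟩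

/-- `𝖲_b(L)`: the subcolocale of joins of complemented sublocales. -/
def Sb (L : Type u) [Order.Frame L] : Subcolocale (Sublocale L) where
  carrier := {S | IsSmooth S}
  sSup_mem' _ hs := isSmooth_sSup hs
  sdiff_mem' _ hd T := hd.sdiff T

/-- `𝖲_𝔬(L)`: the fitted sublocales of `L`, ordered by inclusion. -/
abbrev Fitted (L : Type u) [Order.Frame L] : Type u := {S : Sublocale L // IsFitted S}

namespace Fitted

instance : InfSet (Fitted L) where
  sInf s := ⟨sInf (Subtype.val '' s), isFitted_sInf (by rintro _ ⟨x, -, rfl⟩; exact x.2)⟩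

theorem isGLB_sInf_fitted (s : Set (Fitted L)) : IsGLB s (sInf s) :=
  ⟨fun x hx => show sInf (Subtype.val '' s) ≤ x.1 from sInf_le ⟨x, hx, rfl⟩,
    fun y hy => show y.1 ≤ sInf (Subtype.val '' s) from
      le_sInf (by rintro _ ⟨x, hx, rfl⟩; exact hy hx)⟩

/-- Meets of fitted sublocales are intersections. -/
noncomputable instance : CompleteLattice (Fitted L) :=
  completeLatticeOfInf (Fitted L) isGLB_sInf_fitted

theorem coe_sInf (s : Set (Fitted L)) :
    ((sInf s : Fitted L) : Sublocale L) = sInf (Subtype.val '' s) := rfl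

theorem coe_sup (S T : Fitted L) :
    ((S ⊔ T : Fitted L) : Sublocale L) = (S : Sublocale L) ⊔ (T : Sublocale L) := by
  apply le_antisymm
  · exact show (S ⊔ T : Fitted L) ≤ ⟨(S : Sublocale L) ⊔ T, S.2.sup T.2⟩ from
      sup_le (show (S : Sublocale L) ≤ (S : Sublocale L) ⊔ T from le_sup_left)
        (show (T : Sublocale L) ≤ (S : Sublocale L) ⊔ T from le_sup_right)
  · exact sup_le (show S ≤ S ⊔ T from le_sup_left) (show T ≤ S ⊔ T from le_sup_right)

noncomputable instance : Order.Coframe (Fitted L) := .ofMinimalAxioms {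
  iInf_sup_le_sup_sInf := fun a s => by
    change ((⨅ b ∈ s, a ⊔ b : Fitted L) : Sublocale L) ≤ ((a ⊔ sInf s : Fitted L) : Sublocale L)
    rw [coe_sup, coe_sInf, sup_sInf_eq]
    refine le_iInf₂ fun b hb => ?_
    obtain ⟨b, hb, rfl⟩ := hb
    rw [← coe_sup]
    exact (iInf₂_le b hb : (⨅ b ∈ s, a ⊔ b) ≤ a ⊔ b) }

end Fitted

/-- The fitting as a map `𝖲(L) → 𝖲_𝔬(L)`. -/
def fitMap (S : Sublocale L) : Fitted L := ⟨fit S, isFitted_fit S⟩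

theorem fitMap_le_iff {S : Sublocale L} {F : Fitted L} : fitMap S ≤ F ↔ S ≤ (F : Sublocale L) :=
  fit_le_iff F.2

/-- An open sublocale as an element of `𝖲_𝔬(L)`. -/
def openFitted (a : L) : Fitted L := ⟨opens a, isFitted_opens a⟩

end Sublocale

/-- The direct image `fit[𝒟] ⊆ 𝖲_𝔬(L)` of a subcolocale `𝒟 ⊆ 𝖲(L)`. -/
def Subcolocale.fitImage {L : Type u} [Order.Frame L] (D : Subcolocale (Sublocale L)) :
    Subcolocale (Sublocale.Fitted L) where
  carrier := Sublocale.fitMap '' D.carrier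
  sSup_mem' s hs := by
    refine ⟨sSup {T | T ∈ D.carrier ∧ Sublocale.fitMap T ∈ s},
      D.sSup_mem' _ fun T hT => hT.1, le_antisymm ?_ (sSup_le fun F hF => ?_)⟩
    · rw [Sublocale.fitMap_le_iff]
      exact sSup_le fun T hT => Sublocale.fitMap_le_iff.1 (le_sSup hT.2)
    · obtain ⟨T, hT, rfl⟩ := hs hF
      rw [Sublocale.fitMap_le_iff]
      exact (le_sSup (show T ∈ {T | T ∈ D.carrier ∧ Sublocale.fitMap T ∈ s} from ⟨hT, hF⟩)).trans
        (Sublocale.le_fit _)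
  sdiff_mem' := by
    rintro _ ⟨T, hT, rfl⟩ G
    refine ⟨T \ (G : Sublocale L), D.sdiff_mem' T hT _, eq_of_forall_ge_iff fun H => ?_⟩
    rw [Sublocale.fitMap_le_iff, sdiff_le_iff, sdiff_le_iff, Sublocale.fitMap_le_iff,
      Sublocale.Fitted.coe_sup]

/-! ### Exactness -/

/-- The meet of `X` is exact: it distributes over binary joins. -/
def IsExactMeet {L : Type u} [Order.Frame L] (X : Set L) : Prop :=
  ∀ y : L, sInf X ⊔ y = ⨅ x ∈ X, x ⊔ y

/-- A frame map is exact if it sends exact meets to exact meets and preserves them. -/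
def IsExactFrameHom {L : Type u} {M : Type v} [Order.Frame L] [Order.Frame M]
    (f : FrameHom L M) : Prop :=
  ∀ X : Set L, IsExactMeet X → IsExactMeet (f '' X) ∧ sInf (f '' X) = f (sInf X)

/-- A sublocale is exact if its surjection `L → S` is an exact frame map. -/
def Sublocale.IsExact {L : Type u} [Order.Frame L] (S : Sublocale L) : Prop :=
  IsExactFrameHom S.restrict

/-! ### Strictly zero-dimensional biframes and Raney extensions -/

/-- A strictly zero-dimensional biframe with first component `L`: a codense subcolocale of the
coframe of sublocales of `L`, i.e. one that contains `L` itself. -/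
structure SZDBiframe (L : Type u) [Order.Frame L] where
  sub : Subcolocale (Sublocale L)
  top_mem : ⊤ ∈ sub.carrier

namespace SZDBiframe

variable {L : Type u} [Order.Frame L]

theorem closeds_mem (A : SZDBiframe L) (a : L) : Sublocale.closeds a ∈ A.sub.carrier := by
  have h := A.sub.sdiff_mem' _ A.top_mem (Sublocale.opens a)
  rwa [sdiff_eq_inf_of_isCompl (Sublocale.isCompl_opens_closeds a), top_inf_eq] at h

theorem opens_mem (A : SZDBiframe L) (a : L) : Sublocale.opens a ∈ A.sub.carrier := by
  have h := A.sub.sdiff_mem' _ A.top_mem (Sublocale.closeds a)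
  rwa [sdiff_eq_inf_of_isCompl (Sublocale.isCompl_opens_closeds a).symm, top_inf_eq] at h

/-- The closed sublocale `𝔠(a)` as an element of the subcolocale. -/
def closed (A : SZDBiframe L) (a : L) : A.sub.Elem := ⟨Sublocale.closeds a, A.closeds_mem a⟩

/-- `f : L → M` is (lifts to) a morphism of strictly zero-dimensional biframes if the assignment
`𝔠(a) ↦ 𝔠(f a)` extends to a coframe map between the subcolocales. -/
def IsMorphism {M : Type v} [Order.Frame M] (A : SZDBiframe L) (B : SZDBiframe M)
    (f : FrameHom L M) : Prop :=
  ∃ g : CoframeHom A.sub.Elem B.sub.Elem, ∀ a : L, g.toFun (A.closed a) = B.closed (f a)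

/-- The strictly zero-dimensional biframe `(L, 𝖲_b(L))`. -/
def ofSb (L : Type u) [Order.Frame L] : SZDBiframe L where
  sub := Sublocale.Sb L
  top_mem := ⟨{⊤}, by rintro _ rfl; exact isComplemented_top, by simp⟩

end SZDBiframe

/-- A Raney extension of `L`: a subcolocale of the coframe of fitted sublocales of `L` that
contains all open sublocales. -/
structure RaneyExtension (L : Type u) [Order.Frame L] where
  sub : Subcolocale (Sublocale.Fitted L)
  open_mem : ∀ a : L, Sublocale.openFitted a ∈ sub.carrier

namespace RaneyExtension

variable {L : Type u} [Order.Frame L]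

/-- The open sublocale `𝔬(a)` as an element of the subcolocale. -/
def opn (A : RaneyExtension L) (a : L) : A.sub.Elem := ⟨Sublocale.openFitted a, A.open_mem a⟩

/-- `f : L → M` is (lifts to) a morphism of Raney extensions if the assignment
`𝔬(a) ↦ 𝔬(f a)` extends to a coframe map between the subcolocales. -/
def IsMorphism {M : Type v} [Order.Frame M] (A : RaneyExtension L) (B : RaneyExtension M)
    (f : FrameHom L M) : Prop :=
  ∃ g : CoframeHom A.sub.Elem B.sub.Elem, ∀ a : L, g.toFun (A.opn a) = B.opn (f a)

end RaneyExtension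

/-- The Raney extension `(L, fit[𝒟])` of a strictly zero-dimensional biframe `(L, 𝒟)`. -/
def SZDBiframe.fit {L : Type u} [Order.Frame L] (A : SZDBiframe L) : RaneyExtension L where
  sub := A.sub.fitImage
  open_mem a := ⟨Sublocale.opens a, A.opens_mem a,
    Subtype.ext (Sublocale.fit_eq (Sublocale.isFitted_opens a))⟩

/-! ### Extending maps to coframe maps -/

/-! Meets in `𝖲_b(L)` and in `fit[𝖲_b(L)]` may be smaller than intersections, and the theorem
measures this defect.

Exactness. In `fit[𝖲_b(L)]` the meet of the `𝔬(x)` lies below `𝔬(m)` iff every smooth sublocale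
inside all `𝔬(x)` lies inside `𝔬(m)`. The locally closed `𝔠(z) ∩ 𝔬(w)` suffice as tests, and for
them the condition says `⨅ (x ⊔ z) ≤ m ⊔ z`. So the exact meets are those that `𝔬` preserves
(`isExactMeet_and_sInf_eq_iff_iInf_opn`), and a frame map with a lift is exact. Conversely,
exactness supplies a left adjoint to the candidate lift. This works for every frame map, not only
for surjections onto sublocales.

Smoothness. If `S` is smooth, meeting with `S` inside `𝖲_b(L)` and then tracing on `S` is the lift.
Conversely, a lift sends `𝔬(z) ∨ 𝔠(w)` to `⊤` iff this sublocale contains `S`. Lifts preserve meets,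
so the meet in `𝖲_b(L)` of all these also goes to `⊤`. This forces it to equal `S`, which is
therefore smooth. -/

/-- A map `q` on generators `p` of a coframe `C` extends to a coframe map on `C` as soon as it is
compatible with finite joins and the extension has a left adjoint `l`. -/
theorem exists_coframeHom_of_generators {ι : Type*} {C : Type u} {D : Type v} [SemilatticeSup ι]
    [OrderBot ι] [Order.Coframe C] [Order.Coframe D] {p : ι → C} {q : ι → D} (l : D → C)
    (hp : ∀ F G : C, (∀ x, G ≤ p x → F ≤ p x) → F ≤ G)
    (hp_sup : ∀ a b, p (a ⊔ b) = p a ⊔ p b) (hq_sup : ∀ a b, q (a ⊔ b) = q a ⊔ q b)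
    (hp_bot : p ⊥ = ⊥) (hq_bot : q ⊥ = ⊥) (hl : ∀ G x, l G ≤ p x ↔ G ≤ q x) :
    ∃ g : CoframeHom C D, ∀ a, g.toFun (p a) = q a := by
  -- The largest possible extension. By `hp` the elements `p x` meet-generate `C`, which makes `g`
  -- right adjoint to `l` and hence meet-preserving.
  let g (F : C) : D := ⨅ x ∈ {x | F ≤ p x}, q x
  have hgc : GaloisConnection l g := fun G F => by
    refine ⟨fun h => le_iInf₂ fun x hx => (hl G x).1 (h.trans hx), fun h => hp _ _ fun x hx => ?_⟩
    exact (hl G x).2 (h.trans (iInf₂_le x hx))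
  have hgp (a : ι) : g (p a) = q a := by
    refine le_antisymm (iInf₂_le a (le_refl (p a))) (le_iInf₂ fun x hx => (hl _ x).1 ?_)
    exact ((hl _ a).2 le_rfl).trans hx
  refine ⟨⟨g, fun s => ?_, fun F G => ?_, ?_⟩, hgp⟩
  · rw [hgc.u_sInf, sInf_image]
  · refine le_antisymm ?_ (hgc.monotone_u.le_map_sup F G)
    -- Coframe distributivity turns the join of two meets of generators into a meet of binary joins
    -- of generators.
    simp only [g, iInf_sup_eq, sup_iInf_eq]
    refine le_iInf₂ fun x hx => le_iInf₂ fun y hy => ?_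
    rw [← hq_sup]
    refine iInf₂_le _ ?_
    change F ⊔ G ≤ p _
    rw [hp_sup]
    exact sup_le_sup (by assumption) (by assumption)
  · rw [← hp_bot, hgp, hq_bot]

/-! ### Open and closed sublocales -/

namespace Sublocale

variable {L : Type u} [Order.Frame L]

theorem closeds_anti {a b : L} (h : a ≤ b) : closeds b ≤ closeds a := fun _ hx => h.trans hx

theorem opens_le_opens_iff {a b : L} : opens a ≤ opens b ↔ a ≤ b := by
  refine ⟨fun h => ?_, fun h x hx => ?_⟩
  · have h1 : b ⇨ a ⇨ b = a ⇨ b := h (mem_opens.2 himp_idem)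
    rw [himp_left_comm, himp_self, himp_top] at h1
    exact himp_eq_top_iff.1 h1.symm
  · exact le_antisymm ((himp_le_himp_right h).trans_eq hx) le_himp

theorem opens_bot : opens (⊥ : L) = ⊥ := by
  refine le_bot_iff.1 fun x hx => ?_
  rw [mem_opens, bot_himp] at hx
  exact hx ▸ top_mem

theorem isCompl_opens_sup_closeds (z w : L) :
    IsCompl (opens z ⊔ closeds w) (closeds z ⊓ opens w) :=
  (isCompl_opens_closeds z).sup_inf (isCompl_opens_closeds w).symm

/-- The nucleus of `T` at `z` lies in `T ∩ 𝔠(z)`, and `𝔬(z) ∨ 𝔠(w)` meets `𝔠(z)` inside `𝔠(w)`. In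
the other direction, each `t ∈ T` splits as `(z ⇨ t) ⊓ (w ⊔ t)`. -/
theorem le_opens_sup_closeds_iff {T : Sublocale L} {z w : L} :
    T ≤ opens z ⊔ closeds w ↔ w ≤ (T.restrict z : L) := by
  constructor
  · intro h
    have h1 : closeds z ⊓ (opens z ⊔ closeds w) ≤ closeds w := by
      rw [inf_sup_left, inf_comm, (isCompl_opens_closeds z).inf_eq_bot, bot_sup_eq]
      exact inf_le_right
    exact h1 (mem_inf_of_mem (mem_closeds.2 (T.giRestrict.gc.le_u_l z)) (h (T.restrict z).2))
  · intro h t ht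
    have h1 : (z ⇨ t) ⊓ w ≤ t := by
      rw [inf_comm, ← le_himp_iff]
      refine h.trans ?_
      have : T.restrict z ≤ ⟨(z ⇨ t) ⇨ t, himp_mem ht⟩ :=
        (T.giRestrict.gc z _).2 (by
          change z ≤ (z ⇨ t) ⇨ t
          rw [le_himp_iff, inf_himp]; exact inf_le_right)
      exact this
    have h2 : (z ⇨ t) ⊓ (w ⊔ t) = t := by
      refine le_antisymm ?_ (le_inf le_himp le_sup_right)
      rw [inf_sup_left]
      exact sup_le h1 inf_le_right
    rw [← h2]
    exact inf_mem
      ((le_sup_left : opens z ≤ opens z ⊔ closeds w) (mem_opens.2 himp_idem))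
      ((le_sup_right : closeds w ≤ opens z ⊔ closeds w) (mem_closeds.2 le_sup_left))

theorem coe_restrict_closeds (x z : L) : ((closeds x).restrict z : L) = x ⊔ z := by
  have hm : x ⊔ z ∈ closeds x := mem_closeds.2 le_sup_left
  refine le_antisymm ?_ (sup_le ((closeds x).restrict z).2 ((closeds x).giRestrict.gc.le_u_l z))
  exact ((closeds x).giRestrict.gc z ⟨x ⊔ z, hm⟩).2 le_sup_right

theorem le_opens_iff_closeds_le {C D : Sublocale L} (h : IsCompl C D) {x : L} :
    C ≤ opens x ↔ closeds x ≤ D := by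
  rw [← (isCompl_opens_closeds x).disjoint_right_iff, disjoint_comm, h.disjoint_left_iff]

theorem closeds_inf_opens_le_opens_iff {z w x : L} :
    closeds z ⊓ opens w ≤ opens x ↔ w ≤ x ⊔ z := by
  rw [le_opens_iff_closeds_le (isCompl_opens_sup_closeds z w).symm, le_opens_sup_closeds_iff,
    coe_restrict_closeds]

theorem isSmooth_of_isComplemented {C : Sublocale L} (h : IsComplemented C) : IsSmooth C :=
  ⟨{C}, by rintro _ rfl; exact h, by simp⟩

/-- `𝔬(m)` contains every smooth sublocale contained in all `𝔬(x)`, `x ∈ X`, if and only if the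
corresponding inequalities hold for the locally closed sublocales. -/
theorem forall_isSmooth_le_opens_iff {X : Set L} {m : L} :
    (∀ T : Sublocale L, IsSmooth T → (∀ x ∈ X, T ≤ opens x) → T ≤ opens m) ↔
      ∀ z w : L, (∀ x ∈ X, w ≤ x ⊔ z) → w ≤ m ⊔ z := by
  constructor
  · intro h z w hw
    rw [← closeds_inf_opens_le_opens_iff]
    exact h _ (isSmooth_of_isComplemented ⟨_, (isCompl_opens_sup_closeds z w).symm⟩)
      fun x hx => closeds_inf_opens_le_opens_iff.2 (hw x hx)
  · rintro h _ ⟨𝒞, h𝒞, rfl⟩ hX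
    refine sSup_le fun C hC => ?_
    obtain ⟨D, hD⟩ := h𝒞 C hC
    rw [le_opens_iff_closeds_le hD]
    intro y hy
    -- Testing at `z = y`, with `w` the meet itself, writes `y ≥ m` as a meet of elements `x ⊔ y ∈
    -- 𝔠(x) ⊆ D`; `D` is closed under meets.
    have hy' : ⨅ x ∈ X, x ⊔ y = y := by
      refine le_antisymm ?_ (le_iInf₂ fun x _ => le_sup_right)
      exact (h y _ fun x hx => iInf₂_le x hx).trans (sup_le hy le_rfl)
    rw [← hy']
    refine iInf_mem fun x => iInf_mem fun hx => ?_
    exact (le_opens_iff_closeds_le hD).1 ((le_sSup hC).trans (hX x hx))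
      (mem_closeds.2 le_sup_left)

end Sublocale

/-! ### Exact meets and Raney extensions -/

section Exact

variable {L : Type u} [Order.Frame L]

/-- Recasts exactness in the shape of a test against `𝔠(z) ∩ 𝔬(w)`. Taking `z = ⊥` recovers the
value of the meet; taking `w = ⨅ (x ⊔ z)` recovers distributivity. -/
theorem isExactMeet_and_sInf_eq_iff {X : Set L} {m : L} :
    IsExactMeet X ∧ sInf X = m ↔
      m ∈ lowerBounds X ∧ ∀ z w : L, (∀ x ∈ X, w ≤ x ⊔ z) → w ≤ m ⊔ z := by
  constructor
  · rintro ⟨h, rfl⟩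
    exact ⟨fun x hx => sInf_le hx, fun z w hw => (h z).symm ▸ le_iInf₂ hw⟩
  · rintro ⟨hm, h⟩
    have hX : sInf X = m := by
      refine le_antisymm ?_ (le_sInf hm)
      simpa using h ⊥ (sInf X) fun x hx => by simpa using sInf_le hx
    refine ⟨fun y => le_antisymm ?_ ?_, hX⟩
    · exact le_iInf₂ fun x hx => sup_le_sup_right (sInf_le hx) y
    · rw [hX]
      exact h y _ fun x hx => iInf₂_le x hx

/-- An upper set closed under exact meets contains `y` as soon as `y` is a lower bound of it in the
distributive sense. -/
theorem mem_of_isUpperSet_of_exact {φ : Set L} (hup : IsUpperSet φ)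
    (hex : ∀ X ⊆ φ, IsExactMeet X → sInf X ∈ φ) {y : L}
    (hy : ∀ z w : L, (∀ x ∈ φ, w ≤ x ⊔ z) → w ≤ y ⊔ z) : y ∈ φ := by
  -- Cutting `φ` down to the elements above `y` gives a set whose meet is exactly `y`. It contains
  -- `x ⊔ y` for every `x ∈ φ`, so `hy` applied at `y ⊔ z` shows that the meet is exact.
  obtain ⟨h1, h2⟩ := isExactMeet_and_sInf_eq_iff (X := {x ∈ φ | y ≤ x}) (m := y) |>.2
    ⟨fun x hx => hx.2, fun z w hw => by
      have := hy (y ⊔ z) w fun x hx => by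
        simpa [sup_assoc] using hw (x ⊔ y) ⟨hup le_sup_left hx, le_sup_right⟩
      simpa using this⟩
  exact h2 ▸ hex _ (fun x hx => hx.1) h1

end Exact

/-! ### Opens in `fit[𝖲_b(L)]` and the lifting of exact frame maps -/

namespace SZDBiframe

variable {L : Type u} {M : Type v} [Order.Frame L] [Order.Frame M]

open Sublocale

theorem opn_fit_le_opn_iff (A : SZDBiframe L) {a b : L} : A.fit.opn a ≤ A.fit.opn b ↔ a ≤ b :=
  opens_le_opens_iff

theorem opn_fit_sup (A : SZDBiframe L) (a b : L) :
    A.fit.opn (a ⊔ b) = A.fit.opn a ⊔ A.fit.opn b := by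
  apply Subtype.ext
  apply Subtype.ext
  rw [Subcolocale.coe_sup, Fitted.coe_sup]
  exact opens_sup a b

theorem opn_fit_bot (A : SZDBiframe L) : A.fit.opn ⊥ = ⊥ :=
  le_bot_iff.1 <| (opens_bot.le.trans bot_le : opens (⊥ : L) ≤ _)

theorem fit_elem_le_iff (A : SZDBiframe L) {F G : A.fit.sub.Elem} :
    F ≤ G ↔ ∀ x, G ≤ A.fit.opn x → F ≤ A.fit.opn x := by
  refine ⟨fun h x hx => h.trans hx, fun h => ?_⟩
  obtain ⟨X, hX⟩ := G.1.2
  change F.1.1 ≤ G.1.1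
  rw [hX]
  refine le_iInf₂ fun x hx => h x ?_
  change G.1.1 ≤ opens x
  rw [hX]
  exact iInf₂_le x hx

/-- The meet on the left is the fitting of some smooth sublocale, and fittings of smooth sublocales
are its only test objects. -/
theorem iInf_opn_fit_ofSb_le_iff {X : Set L} {m : L} :
    ⨅ x ∈ X, (ofSb L).fit.opn x ≤ (ofSb L).fit.opn m ↔
      ∀ z w : L, (∀ x ∈ X, w ≤ x ⊔ z) → w ≤ m ⊔ z := by
  rw [← forall_isSmooth_le_opens_iff]
  constructor
  · intro h T hT hX
    let F : (ofSb L).fit.sub.Elem := ⟨fitMap T, T, hT, rfl⟩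
    have hF : F ≤ ⨅ x ∈ X, (ofSb L).fit.opn x :=
      le_iInf₂ fun x hx => (fitMap_le_iff (F := openFitted x)).2 (hX x hx)
    exact (fitMap_le_iff (F := openFitted m)).1 (hF.trans h)
  · intro h
    obtain ⟨T, hT, hTX⟩ := (⨅ x ∈ X, (ofSb L).fit.opn x).2
    change (⨅ x ∈ X, (ofSb L).fit.opn x).1 ≤ openFitted m
    rw [← hTX, fitMap_le_iff]
    refine h T hT fun x hx => ?_
    have hx' : (⨅ x ∈ X, (ofSb L).fit.opn x).1 ≤ openFitted x :=
      (iInf₂_le x hx : ⨅ x ∈ X, (ofSb L).fit.opn x ≤ (ofSb L).fit.opn x)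
    rw [← hTX, fitMap_le_iff] at hx'
    exact hx'

/-- Exact meets are those preserved by `𝔬` as a map into `fit[𝖲_b(L)]`. -/
theorem isExactMeet_and_sInf_eq_iff_iInf_opn {X : Set L} {m : L} :
    IsExactMeet X ∧ sInf X = m ↔
      ⨅ x ∈ X, (ofSb L).fit.opn x = (ofSb L).fit.opn m := by
  rw [isExactMeet_and_sInf_eq_iff, ← iInf_opn_fit_ofSb_le_iff, le_antisymm_iff, and_comm,
    and_congr_right_iff]
  intro _
  simp [lowerBounds, opn_fit_le_opn_iff]

/-- A frame map is exact if and only if it lifts to the Raney extensions `fit[𝖲_b]`. -/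
theorem isExactFrameHom_iff_isMorphism (f : FrameHom L M) :
    IsExactFrameHom f ↔ (ofSb L).fit.IsMorphism (ofSb M).fit f := by
  constructor
  · intro hf
    let l (G : (ofSb M).fit.sub.Elem) : (ofSb L).fit.sub.Elem :=
      ⨅ x ∈ {x | G ≤ (ofSb M).fit.opn (f x)}, (ofSb L).fit.opn x
    have hl (G : (ofSb M).fit.sub.Elem) (y : L) :
        l G ≤ (ofSb L).fit.opn y ↔ G ≤ (ofSb M).fit.opn (f y) := by
      refine ⟨fun h => ?_, fun h => iInf₂_le y h⟩
      -- Exactness of `f` enters here: it makes this upper set closed under exact meets, so `y`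
      -- belongs to it once `𝔬(y)` lies above the meet of its opens.
      refine mem_of_isUpperSet_of_exact (φ := {x | G ≤ (ofSb M).fit.opn (f x)}) ?_ ?_
        (iInf_opn_fit_ofSb_le_iff.1 h)
      · intro a b hab ha
        exact le_trans ha ((opn_fit_le_opn_iff _).2 (OrderHomClass.mono f hab))
      · intro X hX hexact
        have := isExactMeet_and_sInf_eq_iff_iInf_opn.1 (hf X hexact)
        change G ≤ (ofSb M).fit.opn (f (sInf X))
        rw [← this]
        refine le_iInf₂ ?_
        rintro _ ⟨x, hx, rfl⟩
        exact hX hx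
    exact exists_coframeHom_of_generators l (fun _ _ => (fit_elem_le_iff _).2) (opn_fit_sup _)
      (fun a b => by rw [map_sup, opn_fit_sup]) (opn_fit_bot _) (by rw [map_bot, opn_fit_bot]) hl
  · rintro ⟨g, hg⟩ X hX
    rw [isExactMeet_and_sInf_eq_iff_iInf_opn]
    have := isExactMeet_and_sInf_eq_iff_iInf_opn.1 ⟨hX, rfl⟩
    rw [← sInf_image] at this
    rw [← hg, ← this, g.map_sInf', ← sInf_image, Set.image_image, Set.image_image]
    simp only [hg]

end SZDBiframe

/-! ### Sublocales of a sublocale -/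

namespace Sublocale

variable {L : Type u} [Order.Frame L] (S : Sublocale L)

/-- Makes a sublocale of `S` closed under implication by all elements of `L`, not only those of `S`.
-/
theorem restrict_himp_of_mem (a : L) (b : S) : S.restrict a ⇨ b = ⟨a ⇨ b, himp_mem b.2⟩ := by
  refine eq_of_forall_le_iff fun c => ?_
  rw [le_himp_iff, inf_comm, ← le_himp_iff, S.giRestrict.gc a (c ⇨ b)]
  change a ≤ (c : L) ⇨ (b : L) ↔ (c : L) ≤ a ⇨ (b : L)
  exact le_himp_comm

/-- A sublocale of `S`, seen as a sublocale of `L`. -/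
def ofSub (U : Sublocale S) : Sublocale L where
  carrier := {x | ∃ h : x ∈ S, (⟨x, h⟩ : S) ∈ U}
  sInf_mem' s hs := by
    have h : (Subtype.val '' {x : S | (x : L) ∈ s} : Set L) = s := by
      ext x
      exact ⟨by rintro ⟨y, hy, rfl⟩; exact hy, fun hx => ⟨⟨x, (hs hx).1⟩, hx, rfl⟩⟩
    have hU : sInf {x : S | (x : L) ∈ s} ∈ U := sInf_mem fun x hx => (hs hx).2
    have he : ((sInf {x : S | (x : L) ∈ s} : S) : L) = sInf s := by rw [coe_sInf, h]
    exact he ▸ ⟨(sInf {x : S | (x : L) ∈ s}).2, hU⟩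
  himp_mem' := by
    rintro a b ⟨hb, hbU⟩
    exact ⟨himp_mem hb, restrict_himp_of_mem S a ⟨b, hb⟩ ▸ himp_mem hbU⟩

/-- The trace on `S` of a sublocale of `L`. -/
def trace (T : Sublocale L) : Sublocale S where
  carrier := {x | (x : L) ∈ T}
  sInf_mem' s hs := by
    change ((sInf s : S) : L) ∈ T
    rw [coe_sInf]
    exact sInf_mem (by rintro _ ⟨x, hx, rfl⟩; exact hs hx)
  himp_mem' _ b hb := himp_mem (S := T) (b := (b : L)) hb

variable {S}

theorem mem_ofSub {U : Sublocale S} {x : S} : (x : L) ∈ S.ofSub U ↔ x ∈ U :=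
  ⟨fun h => h.2, fun h => ⟨x.2, h⟩⟩

variable (S) in
theorem gc_ofSub_trace : GaloisConnection S.ofSub S.trace := fun _ _ =>
  ⟨fun h _ hx => h (mem_ofSub.2 hx), fun h _ hx => h hx.2⟩

theorem ofSub_le (U : Sublocale S) : S.ofSub U ≤ S := fun _ hx => hx.1

theorem ofSub_le_ofSub_iff {U V : Sublocale S} : S.ofSub U ≤ S.ofSub V ↔ U ≤ V :=
  ⟨fun h _ hx => mem_ofSub.1 (h (mem_ofSub.2 hx)), fun h => (gc_ofSub_trace S).monotone_l h⟩

theorem ofSub_injective : Function.Injective S.ofSub := fun _ _ h =>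
  le_antisymm (ofSub_le_ofSub_iff.1 h.le) (ofSub_le_ofSub_iff.1 h.ge)

theorem ofSub_trace (T : Sublocale L) : S.ofSub (S.trace T) = S ⊓ T :=
  le_antisymm (le_inf (ofSub_le _) ((gc_ofSub_trace S).l_u_le T))
    fun _ hx => ⟨(inf_le_left : S ⊓ T ≤ S) hx, (inf_le_right : S ⊓ T ≤ T) hx⟩

theorem ofSub_trace_of_le {T : Sublocale L} (h : T ≤ S) : S.ofSub (S.trace T) = T := by
  rw [ofSub_trace, inf_eq_right.2 h]

theorem ofSub_top : S.ofSub ⊤ = S := by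
  rw [← (gc_ofSub_trace S).u_top, ofSub_trace, inf_top_eq]

theorem trace_sup (T T' : Sublocale L) : S.trace (T ⊔ T') = S.trace T ⊔ S.trace T' := by
  apply ofSub_injective
  rw [(gc_ofSub_trace S).l_sup]
  simp only [ofSub_trace, inf_sup_left]

theorem trace_bot : S.trace ⊥ = ⊥ := by
  apply ofSub_injective
  rw [(gc_ofSub_trace S).l_bot, ofSub_trace, inf_bot_eq]

theorem isComplemented_trace {C : Sublocale L} (h : IsComplemented C) :
    IsComplemented (S.trace C) := by
  obtain ⟨D, hD⟩ := h
  refine ⟨S.trace D, IsCompl.of_eq ?_ ?_⟩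
  · rw [← (gc_ofSub_trace S).u_inf, hD.inf_eq_bot, trace_bot]
  · rw [← trace_sup, hD.sup_eq_top, (gc_ofSub_trace S).u_top]

/-- Since `T ≤ S`, each complemented piece of `T` is recovered from its trace, so `T` is rebuilt
from the traces. -/
theorem IsSmooth.trace {T : Sublocale L} (hT : IsSmooth T) (h : T ≤ S) :
    IsSmooth (S.trace T) := by
  obtain ⟨𝒞, h𝒞, rfl⟩ := hT
  refine ⟨S.trace '' 𝒞, ?_, ofSub_injective ?_⟩
  · rintro _ ⟨C, hC, rfl⟩
    exact isComplemented_trace (h𝒞 C hC)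
  · rw [ofSub_trace_of_le h, (gc_ofSub_trace S).l_sSup, iSup_image, sSup_eq_iSup]
    exact iSup_congr fun C => iSup_congr fun hC => (ofSub_trace_of_le ((le_sSup hC).trans h)).symm

/-- A smooth sublocale of a smooth sublocale is smooth. -/
theorem IsSmooth.ofSub (hS : IsSmooth S) {U : Sublocale S} (hU : IsSmooth U) :
    IsSmooth (S.ofSub U) := by
  obtain ⟨𝒞, h𝒞, rfl⟩ := hU
  rw [(gc_ofSub_trace S).l_sSup, ← sSup_image]
  refine isSmooth_sSup ?_
  rintro _ ⟨C, hC, rfl⟩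
  obtain ⟨D, hD⟩ := h𝒞 C hC
  have hbot : S.ofSub C ⊓ S.ofSub D = ⊥ := by
    rw [← ofSub_trace_of_le (inf_le_left.trans (ofSub_le C) : S.ofSub C ⊓ S.ofSub D ≤ S),
      ← (gc_ofSub_trace S).l_bot, ← hD.inf_eq_bot]
    congr 1
    refine le_antisymm (fun x hx => ?_) ?_
    · have hx' : (x : L) ∈ S.ofSub C ⊓ S.ofSub D := hx
      exact mem_inf_of_mem (mem_ofSub.1 ((inf_le_left : _ ≤ S.ofSub C) hx'))
        (mem_ofSub.1 ((inf_le_right : _ ≤ S.ofSub D) hx'))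
    · rw [← (gc_ofSub_trace S).le_iff_le]
      exact (gc_ofSub_trace S).monotone_l.map_inf_le C D
  have hsup : S.ofSub D ⊔ S.ofSub C = S := by
    rw [← (gc_ofSub_trace S).l_sup, hD.symm.sup_eq_top, ofSub_top]
  -- A complemented sublocale of `S` need not be complemented in `L`, but it is a difference of the
  -- smooth `S`, and differences preserve smoothness.
  have h : S \ S.ofSub D = S.ofSub C := by
    refine le_antisymm (sdiff_le_iff.2 hsup.ge) ?_
    calc S.ofSub C ≤ S.ofSub C ⊓ (S.ofSub D ⊔ S \ S.ofSub D) :=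
          le_inf le_rfl ((ofSub_le C).trans le_sup_sdiff)
      _ = S.ofSub C ⊓ S \ S.ofSub D := by rw [inf_sup_left, hbot, bot_sup_eq]
      _ ≤ _ := inf_le_right
  exact h ▸ hS.sdiff _

theorem trace_closeds (a : L) : S.trace (closeds a) = closeds (S.restrict a) :=
  Sublocale.ext fun x => (S.giRestrict.gc a x).symm

end Sublocale

/-! ### Smooth sublocales and biframe morphisms -/

namespace SZDBiframe

open Sublocale

variable {L : Type u} [Order.Frame L]

/-- An open sublocale as an element of the subcolocale. -/
def opn (A : SZDBiframe L) (a : L) : A.sub.Elem := ⟨opens a, A.opens_mem a⟩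

theorem isCompl_opn_closed (A : SZDBiframe L) (a : L) : IsCompl (A.opn a) (A.closed a) := by
  have h := isCompl_opens_closeds a
  constructor
  · intro T ho hc
    exact show (T : Sublocale L) ≤ _ from (h.disjoint ho hc).trans bot_le
  · intro T ho hc
    exact show ((⊤ : A.sub.Elem) : Sublocale L) ≤ T from le_top.trans (h.codisjoint ho hc)

theorem opn_sup_closed_eq_top_iff (A : SZDBiframe L) {z w : L} :
    A.opn z ⊔ A.closed w = ⊤ ↔ w ≤ z := by
  rw [← codisjoint_iff, codisjoint_comm, ← (A.isCompl_opn_closed z).symm.left_le_iff]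
  exact ⟨fun h => h (mem_closeds.2 le_rfl), closeds_anti⟩

end SZDBiframe

namespace CoframeHom

variable {C : Type u} {D : Type v} [Order.Coframe C] [Order.Coframe D] (g : CoframeHom C D)

theorem map_top : g.toFun ⊤ = ⊤ := by simpa using g.map_sInf' ∅

theorem map_inf (a b : C) : g.toFun (a ⊓ b) = g.toFun a ⊓ g.toFun b := by
  simpa [Set.image_pair] using g.map_sInf' {a, b}

theorem monotone : Monotone g.toFun := fun a b h => by
  rw [← sup_eq_right.2 h, g.map_sup']
  exact le_sup_left

theorem map_isCompl {a b : C} (h : IsCompl a b) : IsCompl (g.toFun a) (g.toFun b) :=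
  IsCompl.of_eq (by rw [← g.map_inf, h.inf_eq_bot, g.map_bot'])
    (by rw [← g.map_sup', h.sup_eq_top, g.map_top])

end CoframeHom

/-! ### Smoothness of `S` against lifting of its surjection -/

namespace Sublocale

open SZDBiframe

variable {L : Type u} [Order.Frame L] {S : Sublocale L}

theorem IsSmooth.isMorphism (hS : IsSmooth S) : (ofSb L).IsMorphism (ofSb S) S.restrict := by
  let S' : (ofSb L).sub.Elem := ⟨S, hS⟩
  let l (U : (ofSb S).sub.Elem) : (ofSb L).sub.Elem := ⟨S.ofSub U, hS.ofSub U.2⟩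
  have hle (T : (ofSb L).sub.Elem) : ((S' ⊓ T : (ofSb L).sub.Elem) : Sublocale L) ≤ S :=
    (inf_le_left : S' ⊓ T ≤ S')
  -- The meet with `S` is taken in `𝖲_b(L)`, so that the result stays smooth. Embedding back gives
  -- `S' ⊓ T`, which reduces preservation of joins to distributivity in `𝖲_b(L)`.
  let g (T : (ofSb L).sub.Elem) : (ofSb S).sub.Elem :=
    ⟨S.trace (S' ⊓ T : (ofSb L).sub.Elem), IsSmooth.trace (S' ⊓ T).2 (hle T)⟩
  have hlg (T : (ofSb L).sub.Elem) : l (g T) = S' ⊓ T := Subtype.ext (ofSub_trace_of_le (hle T))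
  have hl_le {U V : (ofSb S).sub.Elem} : l U ≤ l V ↔ U ≤ V := ofSub_le_ofSub_iff
  have hgc : GaloisConnection l g := fun U T => by
    rw [← hl_le, hlg]
    exact ⟨fun h => le_inf (show S.ofSub U ≤ S from ofSub_le _) h, fun h => h.trans inf_le_right⟩
  have hl_inj {U V : (ofSb S).sub.Elem} (h : l U = l V) : U = V :=
    le_antisymm (hl_le.1 h.le) (hl_le.1 h.ge)
  refine ⟨⟨g, fun s => ?_, fun T T' => hl_inj ?_, hl_inj ?_⟩, fun a => ?_⟩
  · rw [hgc.u_sInf, sInf_image]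
  · rw [hgc.l_sup, hlg, hlg, hlg, inf_sup_left]
  · rw [hlg, hgc.l_bot, inf_bot_eq]
  · have ht : S.trace (closeds a) = closeds (S.restrict a) := trace_closeds a
    refine le_antisymm ?_ ((hgc _ _).1 ?_)
    · change S.trace _ ≤ closeds (S.restrict a)
      rw [← ht]
      exact (gc_ofSub_trace S).monotone_u
        (inf_le_right : S' ⊓ (ofSb L).closed a ≤ (ofSb L).closed a)
    · change S.ofSub (closeds (S.restrict a)) ≤ closeds a
      rw [← ht]
      exact (gc_ofSub_trace S).l_u_le _

theorem isSmooth_of_isMorphism (h : (ofSb L).IsMorphism (ofSb S) S.restrict) : IsSmooth S := by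
  obtain ⟨g, hg⟩ := h
  -- Coframe maps preserve complements and complements are unique, so the values on closed
  -- sublocales determine those on opens.
  have hgo (a : L) : g.toFun ((ofSb L).opn a) = (ofSb S).opn (S.restrict a) :=
    (g.map_isCompl (isCompl_opn_closed _ a)).left_unique (hg a ▸ isCompl_opn_closed _ _)
  have hgP (z w : L) : g.toFun ((ofSb L).opn z ⊔ (ofSb L).closed w) = ⊤ ↔
      S ≤ opens z ⊔ closeds w := by
    rw [g.map_sup', hgo, hg, le_opens_sup_closeds_iff, opn_sup_closed_eq_top_iff]
    exact S.giRestrict.gc w _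
  let 𝒬 : Set (ofSb L).sub.Elem :=
    {P | ∃ z w, S ≤ opens z ⊔ closeds w ∧ P = (ofSb L).opn z ⊔ (ofSb L).closed w}
  have htop : g.toFun (sInf 𝒬) = ⊤ := by
    rw [g.map_sInf', sInf_eq_top]
    rintro _ ⟨_, ⟨z, w, hzw, rfl⟩, rfl⟩
    exact (hgP z w).2 hzw
  have hS : S = (sInf 𝒬 : (ofSb L).sub.Elem) := by
    apply le_antisymm
    · rw [eq_sInf_opens_sup_closeds (sInf 𝒬).1]
      refine le_sInf ?_
      rintro _ ⟨hP, z, w, rfl⟩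
      -- Any `𝔬(z) ∨ 𝔠(w)` above the meet of `𝒬` is sent to `⊤` by monotonicity, hence contains `S`.
      rw [← hgP, ← top_le_iff, ← htop]
      refine g.monotone ?_
      change _ ≤ (((ofSb L).opn z ⊔ (ofSb L).closed w : (ofSb L).sub.Elem) : Sublocale L)
      rw [Subcolocale.coe_sup]
      exact hP
    · rw [eq_sInf_opens_sup_closeds S]
      refine le_sInf ?_
      rintro _ ⟨hP, z, w, rfl⟩
      have : sInf 𝒬 ≤ (ofSb L).opn z ⊔ (ofSb L).closed w := sInf_le ⟨z, w, hP, rfl⟩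
      refine (show ((sInf 𝒬 : (ofSb L).sub.Elem) : Sublocale L) ≤ _ from this).trans_eq ?_
      rw [Subcolocale.coe_sup]
      rfl
  exact hS ▸ (sInf 𝒬).2

end Sublocale

theorem mainTheorem9 {L : Type u} [Order.Frame L] (S : Sublocale L) :
    (S.IsSmooth ↔
      SZDBiframe.IsMorphism (SZDBiframe.ofSb L) (SZDBiframe.ofSb S) S.restrict) ∧
    (S.IsExact ↔
      RaneyExtension.IsMorphism (SZDBiframe.ofSb L).fit (SZDBiframe.ofSb S).fit S.restrict) :=
  ⟨⟨fun h => h.isMorphism, Sublocale.isSmooth_of_isMorphism⟩,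
    SZDBiframe.isExactFrameHom_iff_isMorphism S.restrict⟩
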